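/- Let $\varepsilon_0,\varepsilon_1,\varepsilon_2,\dots$ be i.i.d. real random variables with distribution function $F$ such that, for some $\mathfrak a,\delta,\tilde\delta,c,c_g,L_\varepsilon,\beta_\varepsilon>0$: (i) $|F(y)-c\,y^{\mathfrak a}|\le c_g\,y^{\mathfrak a+\delta}$ for all sufficiently small $y>0$ (so that $\varepsilon_k>0$ almost surely) and $F\in\mathcal H(L_\varepsilon,\beta_\varepsilon)$; (ii) $\mathbb E\,\varepsilon_1^p<\infty$ for all $0<p\le\max\{1,2\mathfrak a+\tilde\delta\}$. Here, for $L,\beta>0$, with $\langle\beta\rangle$ the largest integer $\ge 0$ that is strictly less than $\beta$, the Hölder class $\mathcal H(L,\beta)$ consists of the functions $g$ that are $\langle\beta\rangle$ times differentiable on $[0,1]$ with $|g^{(\langle\beta\rangle)}(y)-g^{(\langle\beta\rangle)}(z)|\le L|y-z|^{\beta-\langle\beta\rangle}$ for all $y,z\in[0,1]$. Fix $L,\beta>0$, $\rho<1$ and $x\in[0,1]$. For $f\in\mathcal H(L,\beta)$ with $0\le f\le\rho$ on $[0,1]$ and $N\in\mathbb N$, let $$X_k=f(k/N)\,X_{k-1}+\varepsilon_k,\qquad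 k=1,\dots,N,$$ where $X_0$ is an almost surely positive random variable, not necessarily independent of the innovations (in particular, $X_0$ may be the value at time $0$ of the causal solution of the recursion on $\mathbb Z$, with $f$ extended constantly outside $[0,1]$). Put $Y_k=X_k/X_{k-1}$ and $h^*=N^{-1/(\mathfrak a\beta+1)}$. Fix a degree $d\ge\langle\beta\rangle$, and let $(\hat b_0,\dots,\hat b_d)$ be any maximizer of $$\sum_{1\le k\le N,\ |k/N-x|\le h^*}p_b(k/N),\qquad p_b(y)=\sum_{i=0}^d b_i(y-x)^i,$$ over all $b\in\mathbb R^{d+1}$ with $p_b(k/N)\le Y_k$ for all $1\le k\le N$ with $|k/N-x|\le h^*$. Let $\hat f(x)=\hat f_{h^*}(x):=\hat b_0$. Then $$|\hat f(x)-f(x)|=\mathcal O_{\mathbb P_f}\!\left(N^{-\beta/(\mathfrak a\beta+1)}\right),$$ uniformly in $f$ and in the choice of $X_0$ and of the maximizer: for every $\eta>0$ there are $v\in(0,\infty)$ and $N_0\in\mathbb N$ such that for all $N\ge N_0$, all $f\in\mathcal H(L,\beta)$ with $0\le f\le\rho$, all such $X_0$ and all choices of the maximizer, $$\mathbb P_f\!\left(|\hat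 f(x)-f(x)|\ge v\,N^{-\beta/(\mathfrak a\beta+1)}\right)<\eta .$$ -/

import Mathlib

open MeasureTheory ProbabilityTheory Filter Topology

noncomputable section

namespace TvAR

/-- The largest natural number strictly less than `β` (for `β > 0`). -/
def holderOrder (β : ℝ) : ℕ := ⌈β⌉₊ - 1

theorem isGreatest_holderOrder {β : ℝ} (hβ : 0 < β) :
    IsGreatest {m : ℕ | (m : ℝ) < β} (holderOrder β) := by
  have h1 : 0 < ⌈β⌉₊ := Nat.ceil_pos.2 hβ
  refine ⟨?_, fun m hm => ?_⟩
  · have : holderOrder β < ⌈β⌉₊ := by unfold holderOrder; omega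
    exact Nat.lt_ceil.1 this
  · have : m < ⌈β⌉₊ := Nat.lt_ceil.2 hm
    unfold holderOrder; omega

/-- The Hölder class `H(L, β)` on `[0,1]`: with `m` the largest integer less than `β`, the `m`-th
derivative exists on `[0,1]` (one-sided at the endpoints) and is `(β - m)`-Hölder with
constant `L`; continuity of the `m`-th derivative is automatic because `β - m > 0`. Only the
values of `g` on `[0,1]` matter. -/
structure HolderClass (L β : ℝ) (g : ℝ → ℝ) : Prop where
  contDiffOn : ContDiffOn ℝ (holderOrder β : ℕ) g (Set.Icc 0 1)
  holder : ∀ y ∈ Set.Icc (0 : ℝ) 1, ∀ z ∈ Set.Icc (0 : ℝ) 1,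
    |iteratedDerivWithin (holderOrder β) g (Set.Icc 0 1) y
      - iteratedDerivWithin (holderOrder β) g (Set.Icc 0 1) z|
      ≤ L * |y - z| ^ (β - (holderOrder β : ℝ))

/-- Distribution function of a real random variable. -/
def distFun {Ω : Type*} [MeasurableSpace Ω] (μ : Measure Ω) (Z : Ω → ℝ) (y : ℝ) : ℝ :=
  μ.real {ω | Z ω ≤ y}

/-- The assumptions on the innovations: iid; the distribution function behaves like `c * y ^ a`
as `y ↓ 0`, up to an error of order `y ^ (a + δ)`, and belongs to a Hölder class; moments of all
positive orders up to `max 1 (2 * a + δ')` are finite. -/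
structure Innovations {Ω : Type*} [MeasurableSpace Ω] (μ : Measure Ω) (a : ℝ)
    (ε : ℕ → Ω → ℝ) : Prop where
  aemeasurable : ∀ k, AEMeasurable (ε k) μ
  indep : iIndepFun ε μ
  ident : ∀ k, IdentDistrib (ε k) (ε 0) μ μ
  a_pos : 0 < a
  sharp : ∃ δ > 0, ∃ c > 0, ∃ cg > 0, ∀ᶠ y in 𝓝[>] (0 : ℝ),
    |distFun μ (ε 0) y - c * y ^ a| ≤ cg * y ^ (a + δ)
  holder : ∃ Lε > 0, ∃ βε > 0, HolderClass Lε βε (distFun μ (ε 0))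
  moment : ∃ δ' > 0, ∀ p : ℝ, 0 < p → p ≤ max 1 (2 * a + δ') →
    Integrable (fun ω => ε 0 ω ^ p) μ

/-- The time-varying AR(1) process `X_k = f (k / N) * X_{k-1} + ε_k`, `k ≥ 1`, started at `X₀`. -/
def process {Ω : Type*} (f : ℝ → ℝ) (ε : ℕ → Ω → ℝ) (X₀ : Ω → ℝ) (N : ℕ) : ℕ → Ω → ℝ
  | 0, ω => X₀ ω
  | k + 1, ω => f (((k + 1 : ℕ) : ℝ) / N) * process f ε X₀ N k ω + ε (k + 1) ω

/-- The quotients `Y_k = X_k / X_{k-1}`, `k ≥ 1`. -/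
def quotient {Ω : Type*} (f : ℝ → ℝ) (ε : ℕ → Ω → ℝ) (X₀ : Ω → ℝ) (N k : ℕ) (ω : Ω) : ℝ :=
  process f ε X₀ N k ω / process f ε X₀ N (k - 1) ω

/-- The indices `k ∈ {1, …, N}` with `|k / N - x| ≤ h`. -/
def window (N : ℕ) (h x : ℝ) : Finset ℕ :=
  (Finset.Icc 1 N).filter fun k => |(k : ℝ) / N - x| ≤ h

/-- The polynomial `∑ i ≤ d, b i * (y - x) ^ i`. -/
def localPoly {d : ℕ} (x : ℝ) (b : Fin (d + 1) → ℝ) (y : ℝ) : ℝ :=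
  ∑ i, b i * (y - x) ^ (i : ℕ)

/-- The coefficient vectors `b` with `p_b (k / N) ≤ Y k` for all `k` in the window. -/
def feasible (d N : ℕ) (h x : ℝ) (Y : ℕ → ℝ) : Set (Fin (d + 1) → ℝ) :=
  {b | ∀ k ∈ window N h x, localPoly x b ((k : ℝ) / N) ≤ Y k}

/-- The sum of the values of `p_b` at the design points in the window. -/
def objective {d : ℕ} (N : ℕ) (h x : ℝ) (b : Fin (d + 1) → ℝ) : ℝ :=
  ∑ k ∈ window N h x, localPoly x b ((k : ℝ) / N)

/-- `b` solves the linear program of the quasi-maximum-likelihood estimator with bandwidth `h` at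
the point `x` for the data `Y`; the estimate of `f x` is then `b 0`. -/
def IsQuasiMLE (d N : ℕ) (h x : ℝ) (Y : ℕ → ℝ) (b : Fin (d + 1) → ℝ) : Prop :=
  b ∈ feasible d N h x Y ∧ IsMaxOn (objective N h x) (feasible d N h x Y) b

/-- The linear program always has a solution. -/
theorem exists_isQuasiMLE (d N : ℕ) (h x : ℝ) (Y : ℕ → ℝ) :
    ∃ b : Fin (d + 1) → ℝ, IsQuasiMLE d N h x Y b := by
  classical
  let W := window N h x
  let T : (Fin (d + 1) → ℝ) →ₗ[ℝ] (W → ℝ) :=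
    { toFun := fun b k => localPoly x b (((k : ℕ) : ℝ) / N)
      map_add' := fun b b' => by
        funext k; simp [localPoly, add_mul, Finset.sum_add_distrib]
      map_smul' := fun c b => by
        funext k; simp [localPoly, Finset.mul_sum, mul_assoc] }
  have hobj : ∀ b, objective N h x b = ∑ k, T b k := fun b => by
    change ∑ k ∈ W, localPoly x b ((k : ℝ) / N) = _
    rw [← Finset.sum_coe_sort]
    rfl
  have hfea : ∀ b, b ∈ feasible d N h x Y ↔ ∀ k : W, T b k ≤ Y k := fun b =>
    ⟨fun hb k => hb k k.2, fun hb k hk => hb ⟨k, hk⟩⟩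
  -- a feasible constant polynomial
  let m : ℝ := -∑ k ∈ W, |Y k|
  let b₀ : Fin (d + 1) → ℝ := Pi.single 0 m
  have hT0 : ∀ k, T b₀ k = m := fun k => by
    change ∑ i, b₀ i * _ ^ (i : ℕ) = m
    rw [Finset.sum_eq_single 0] <;> simp +contextual [b₀]
  have hb0 : ∀ k : W, T b₀ k ≤ Y k := fun k => by
    rw [hT0]
    have h1 : |Y k| ≤ ∑ k ∈ W, |Y k| :=
      Finset.single_le_sum (f := fun k => |Y k|) (fun i _ => abs_nonneg _) k.2
    have h2 := neg_abs_le (Y k)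
    simp only [m]; linarith
  let K : Set (W → ℝ) := (LinearMap.range T : Set (W → ℝ)) ∩
    ({w | ∀ k, w k ≤ Y k} ∩ {w | ∑ k, T b₀ k ≤ ∑ k, w k})
  have hKclosed : IsClosed K := by
    refine (Submodule.closed_of_finiteDimensional _).inter (IsClosed.inter ?_ ?_)
    · simp only [Set.ofPred_forall]
      exact isClosed_iInter fun k => isClosed_le (continuous_apply k) continuous_const
    · exact isClosed_le continuous_const (by fun_prop)
  let R : ℝ := ∑ k, T b₀ k - ∑ k : W, |Y k|
  have hKsub : K ⊆ Set.Icc (fun _ => R) (fun k : W => Y k) := by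
    rintro w ⟨-, hw1, hw2⟩
    refine ⟨fun k => ?_, hw1⟩
    have h1 : ∑ j, w j = w k + ∑ j ∈ Finset.univ.erase k, w j :=
      (Finset.add_sum_erase _ _ (Finset.mem_univ k)).symm
    have h2 : ∑ j ∈ Finset.univ.erase k, w j ≤ ∑ j : W, |Y j| :=
      (Finset.sum_le_sum fun j _ => (hw1 j).trans (le_abs_self _)).trans
        (Finset.sum_le_sum_of_subset_of_nonneg (Finset.erase_subset _ _)
          fun j _ _ => abs_nonneg _)
    have h3 : ∑ j, T b₀ j ≤ ∑ j, w j := hw2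
    simp only [R]; linarith
  have hK : IsCompact K := isCompact_Icc.of_isClosed_subset hKclosed hKsub
  have hKne : K.Nonempty := ⟨T b₀, ⟨b₀, rfl⟩, hb0, le_refl (∑ k, T b₀ k)⟩
  obtain ⟨w, hw, hmax⟩ := hK.exists_isMaxOn hKne
    (f := fun w : W → ℝ => ∑ k, w k) (by fun_prop)
  obtain ⟨⟨b, rfl⟩, hw1, hw2⟩ := hw
  refine ⟨b, (hfea b).2 hw1, fun b' hb' => ?_⟩
  change objective N h x b' ≤ objective N h x b
  rw [hobj, hobj]
  by_cases hc : ∑ k, T b₀ k ≤ ∑ k, T b' k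
  · exact hmax (show T b' ∈ K from ⟨⟨b', rfl⟩, (hfea b').1 hb', hc⟩)
  · exact (not_le.1 hc).le.trans hw2

/-- The bandwidth `N ^ (-1 / (a * β + 1))`. -/
def bandwidth (a β : ℝ) (N : ℕ) : ℝ := (N : ℝ) ^ (-1 / (a * β + 1))

end TvAR

end

/-! The noise is one-sided: `Y_k = f (k / N) + ε_k / X_{k-1}` lies above the regression function, so
fitting is a boundary problem. Let `B = L * h ^ β` bound the Taylor remainder of `f` on the window.
The Taylor polynomial lowered by `B` is feasible, so the maximizer exceeds it on average over the
window.

The maximizer cannot exceed it by much anywhere. Split the rescaled window into at most `2 * J`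
cells, `J` fixed. If each contains some `k` with `Y_k ≤ f (k / N) + t`, the rescaled difference
polynomial has nonnegative sum and is at most `t + 2 * B` on a fine net. In a finite-dimensional
space of polynomials this bounds all coefficients by a multiple of `t + 2 * B`
(`exists_norm_le_of_sum_nonneg`, `exists_abs_sub_le`).

For a good index it suffices that `ε_{k-1} ≥ s` and `ε_k ≤ t * s`, because `X_{k-1} ≥ ε_{k-1}`. This
needs no control of `X₀` and involves only innovations; disjoint pairs are independent, each
succeeding with probability of order at least `t ^ a`. With `t = w * h ^ β` and order `N * h` pairs
per cell, the identity `N * h * (h ^ β) ^ a = 1` makes a cell fail with probability at most `exp (-κ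
* w ^ a)`. A union bound over cells and a large `w` finish. -/

namespace TvAR

/-! ### Taylor approximation in the Hölder class -/

/-- Taylor's theorem for functions whose highest derivative is Hölder continuous at `x`. -/
theorem abs_sub_taylorWithinEval_le {s : Set ℝ} (hs : Convex ℝ s) (hu : UniqueDiffOn ℝ s)
    {L γ x : ℝ} (hL : 0 ≤ L) (hγ : 0 ≤ γ) (hx : x ∈ s) (n : ℕ) {g : ℝ → ℝ}
    (hg : ContDiffOn ℝ n g s)
    (hH : ∀ y ∈ s, |iteratedDerivWithin n g s y - iteratedDerivWithin n g s x| ≤ L * |y - x| ^ γ)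
    {y : ℝ} (hy : y ∈ s) :
    |g y - taylorWithinEval g n s x y| ≤ L * |y - x| ^ γ * |y - x| ^ n := by
  induction n generalizing g y with
  | zero => simpa using hH y hy
  | succ n ih =>
    have hg' : ContDiffOn ℝ n (derivWithin g s) s := hg.derivWithin hu (by norm_cast)
    have key : ∀ z ∈ s, |derivWithin g s z - taylorWithinEval (derivWithin g s) n s x z|
        ≤ L * |z - x| ^ γ * |z - x| ^ n := fun z hz => by
      refine ih hg' (fun w hw => ?_) hz
      simpa only [iteratedDerivWithin_succ'] using hH w hw
    have hsub : segment ℝ x y ⊆ s := hs.segment_subset hx hy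
    have hle : ∀ z ∈ segment ℝ x y, |z - x| ≤ |y - x| := fun z hz => by
      rw [segment_eq_uIcc] at hz
      exact Set.abs_sub_left_of_mem_uIcc hz
    -- The derivative of the Taylor remainder of `g` is the remainder of `g'` one order lower, which
    -- the induction hypothesis bounds; the mean value inequality supplies the extra factor `|y -
    -- x|`.
    have h := (convex_segment x y).norm_image_sub_le_of_norm_hasDerivWithin_le
      (f := fun z => g z - taylorWithinEval g (n + 1) s x z)
      (f' := fun z => derivWithin g s z - taylorWithinEval (derivWithin g s) n s x z)
      (C := L * |y - x| ^ γ * |y - x| ^ n)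
      (fun z hz => ((hg.differentiableOn (by simp) z (hsub hz)).hasDerivWithinAt.sub
        (hasDerivAt_taylorWithinEval_succ g n).hasDerivWithinAt).mono hsub)
      (fun z hz => (key z (hsub hz)).trans (by have := hle z hz; gcongr))
      (left_mem_segment ℝ x y) (right_mem_segment ℝ x y)
    simp only [taylorWithinEval_self, sub_self, sub_zero, Real.norm_eq_abs] at h
    rw [pow_succ, ← mul_assoc]
    exact h

theorem HolderClass.exists_localPoly {L β : ℝ} {f : ℝ → ℝ} (hf : HolderClass L β f) (hL : 0 ≤ L)
    (hβ : 0 < β) {d : ℕ} (hd : holderOrder β ≤ d) {x : ℝ} (hx : x ∈ Set.Icc (0 : ℝ) 1) :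
    ∃ b : Fin (d + 1) → ℝ, b 0 = f x ∧
      ∀ y ∈ Set.Icc (0 : ℝ) 1, |f y - localPoly x b y| ≤ L * |y - x| ^ β := by
  set m := holderOrder β
  have hm : (m : ℝ) < β := (isGreatest_holderOrder hβ).1
  -- The degree `d` may exceed the Hölder order `m`, so the Taylor coefficients are padded with
  -- zeros.
  let q : ℕ → ℝ := fun i => if i ≤ m then
    ((i.factorial : ℝ)⁻¹) * iteratedDerivWithin i f (Set.Icc 0 1) x else 0
  refine ⟨fun i => q i, by simp [q], fun y hy => ?_⟩
  have hT : localPoly x (fun i : Fin (d + 1) => q i) y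
      = taylorWithinEval f m (Set.Icc 0 1) x y := by
    rw [taylor_within_apply, localPoly, Fin.sum_univ_eq_sum_range (fun i => q i * (y - x) ^ i)]
    symm
    rw [← Finset.sum_subset (Finset.range_mono (Nat.succ_le_succ hd))]
    · refine Finset.sum_congr rfl fun i hi => ?_
      have : i ≤ m := Nat.lt_succ_iff.1 (Finset.mem_range.1 hi)
      simp only [q, this, if_true, smul_eq_mul]
      ring
    · intro i _ hi
      have : ¬ i ≤ m := fun h => hi (Finset.mem_range.2 (Nat.lt_succ_iff.2 h))
      simp [q, this]
  rw [hT]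
  refine (abs_sub_taylorWithinEval_le (convex_Icc 0 1) (uniqueDiffOn_Icc one_pos) hL
    (sub_nonneg.2 hm.le) hx m hf.contDiffOn (fun z hz => hf.holder z hz x hx) hy).trans_eq ?_
  rw [mul_assoc, ← Real.rpow_natCast, ← Real.rpow_add_of_nonneg (abs_nonneg _)
    (sub_nonneg.2 hm.le) (Nat.cast_nonneg _), sub_add_cancel]

/-! ### Norm estimates for polynomials of bounded degree -/

section Polynomial

variable {d : ℕ}

theorem abs_localPoly_zero_sub_le (c : Fin (d + 1) → ℝ) {u w : ℝ} (hu : |u| ≤ 1) (hw : |w| ≤ 1) :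
    |localPoly 0 c u - localPoly 0 c w| ≤ (d + 1) ^ 2 * ‖c‖ * |u - w| := by
  have h : ∀ i : Fin (d + 1), |c i * (u - 0) ^ (i : ℕ) - c i * (w - 0) ^ (i : ℕ)|
      ≤ ‖c‖ * (|u - w| * (d + 1)) := fun i => by
    rw [← mul_sub, abs_mul, sub_zero, sub_zero]
    have h1 : |c i| ≤ ‖c‖ := norm_le_pi_norm c i
    have h2 := abs_pow_sub_pow_le u w (i : ℕ)
    have h3 : max |u| |w| ^ ((i : ℕ) - 1) ≤ 1 :=
      pow_le_one₀ (le_max_of_le_left (abs_nonneg _)) (max_le hu hw)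
    have h4 : ((i : ℕ) : ℝ) ≤ d + 1 := by exact_mod_cast i.2.le
    have h5 : |u ^ (i : ℕ) - w ^ (i : ℕ)| ≤ |u - w| * (d + 1) := by
      refine h2.trans ?_
      calc |u - w| * ((i : ℕ) : ℝ) * max |u| |w| ^ ((i : ℕ) - 1)
          ≤ |u - w| * ((i : ℕ) : ℝ) * 1 := by gcongr
        _ ≤ |u - w| * (d + 1) := by rw [mul_one]; gcongr
    gcongr
  rw [localPoly, localPoly, ← Finset.sum_sub_distrib]
  refine (Finset.abs_sum_le_sum_abs _ _).trans ((Finset.sum_le_sum fun i _ => h i).trans_eq ?_)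
  simp
  ring

/-- The coefficients of a polynomial are controlled by its values at `d + 1` distinct points. -/
theorem exists_norm_le_of_localPoly_le {v : Fin (d + 1) → ℝ} (hv : Function.Injective v) :
    ∃ A : ℝ, 0 < A ∧ ∀ (c : Fin (d + 1) → ℝ) (R : ℝ), 0 ≤ R →
      (∀ i, |localPoly 0 c (v i)| ≤ R) → ‖c‖ ≤ A * R := by
  have hinj : Function.Injective (Matrix.mulVecLin (Matrix.vandermonde v)) := by
    rw [← LinearMap.ker_eq_bot, LinearMap.ker_eq_bot']
    intro c hc
    exact Matrix.eq_zero_of_mulVec_eq_zero (Matrix.det_vandermonde_ne_zero_iff.2 hv) hc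
  -- An injective linear map on a finite-dimensional space is bounded below; its constant serves as
  -- `A`.
  obtain ⟨K, hK, hA⟩ := (LinearMap.injective_iff_antilipschitz _).1 hinj
  refine ⟨K, hK, fun c R hR hc => ?_⟩
  have h := hA.le_mul_dist c 0
  rw [map_zero, dist_zero_right, dist_zero_right] at h
  refine h.trans (mul_le_mul_of_nonneg_left ((pi_norm_le_iff_of_nonneg hR).2 fun i => ?_) K.2)
  have : Matrix.mulVecLin (Matrix.vandermonde v) c i = localPoly 0 c (v i) := by
    simp [Matrix.mulVec, dotProduct, localPoly, mul_comm]
  rw [this]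
  exact hc i

/-- A polynomial with nonnegative sum over design points, that is at most `T` at a sufficiently
dense subset of them, has coefficients of order `T`. -/
theorem exists_norm_le_of_sum_nonneg {v : Fin (d + 1) → ℝ} (hv : Function.Injective v)
    (hv1 : ∀ i, |v i| ≤ 1) :
    ∃ τ : ℝ, 0 < τ ∧ ∀ γ : ℝ, 0 < γ → ∃ r : ℝ, 0 < r ∧ ∃ C : ℝ, 0 < C ∧
      ∀ (W : Finset ℕ) (u : ℕ → ℝ) (c : Fin (d + 1) → ℝ) (T : ℝ), 0 ≤ T → W.Nonempty →
        (∀ k ∈ W, |u k| ≤ 1) → 0 ≤ ∑ k ∈ W, localPoly 0 c (u k) →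
        (∀ k ∈ W, ∃ k' ∈ W, |u k - u k'| ≤ r ∧ localPoly 0 c (u k') ≤ T) →
        (∀ i, ∃ V ⊆ W, γ * W.card ≤ V.card ∧ ∀ k ∈ V, |v i - u k| ≤ τ) →
        ‖c‖ ≤ C * T := by
  obtain ⟨A, hA, hAc⟩ := exists_norm_le_of_localPoly_le hv
  set K : ℝ := (d + 1) ^ 2
  have hK : 0 < K := by positivity
  -- `τ` and `r` are tuned so that each of the two error terms proportional to `‖c‖` in the final
  -- bound has coefficient `1 / 4`; together they are absorbed on the left. `τ` precedes `γ` because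
  -- the caller's `γ` depends on `τ`.
  refine ⟨1 / (4 * (A * K)), by positivity, fun γ hγ => ?_⟩
  refine ⟨1 / (4 * (A * K) * (1 + 1 / γ)), by positivity, 2 * A * (1 + 1 / γ), by positivity, ?_⟩
  intro W u c T hT hW hu hsum hdense hnear
  set r : ℝ := 1 / (4 * (A * K) * (1 + 1 / γ)) with hr
  set τ : ℝ := 1 / (4 * (A * K)) with hτ
  have hr0 : 0 < r := by positivity
  have hc0 : 0 ≤ ‖c‖ := norm_nonneg c
  set T' : ℝ := T + K * ‖c‖ * r
  have hT' : 0 ≤ T' := by positivity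
  have hup : ∀ k ∈ W, localPoly 0 c (u k) ≤ T' := fun k hk => by
    obtain ⟨k', hk', h1, h2⟩ := hdense k hk
    have h3 := (abs_le.1 (abs_localPoly_zero_sub_le c (hu k hk) (hu k' hk'))).2
    have h4 : (d + 1 : ℝ) ^ 2 * ‖c‖ * |u k - u k'| ≤ K * ‖c‖ * r := by gcongr
    linarith
  have hWc : 0 < (W.card : ℝ) := by exact_mod_cast hW.card_pos
  have hR : ∀ i, |localPoly 0 c (v i)| ≤ T' * (1 + 1 / γ) + K * ‖c‖ * τ := fun i => by
    obtain ⟨V, hVW, hV, hVτ⟩ := hnear i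
    have hVc : 0 < (V.card : ℝ) := (mul_pos hγ hWc).trans_le hV
    -- Were the polynomial below `-(T' / γ)` on all of `V`, that deficit would outweigh the upper
    -- bound `T'` on the rest of `W`, making the sum negative.
    obtain ⟨k, hk, hlow⟩ : ∃ k ∈ V, -(T' / γ) ≤ localPoly 0 c (u k) := by
      by_contra! hcon
      have h1 : ∑ k ∈ V, localPoly 0 c (u k) < ∑ k ∈ V, -(T' / γ) :=
        Finset.sum_lt_sum_of_nonempty (Finset.card_pos.1 (by exact_mod_cast hVc)) hcon
      have h2 : ∑ k ∈ W \ V, localPoly 0 c (u k) ≤ ∑ k ∈ W \ V, T' :=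
        Finset.sum_le_sum fun k hk => hup k (Finset.sdiff_subset hk)
      have h3 : ∑ k ∈ W \ V, T' ≤ ∑ k ∈ W, T' :=
        Finset.sum_le_sum_of_subset_of_nonneg Finset.sdiff_subset fun _ _ _ => hT'
      have h4 := Finset.sum_sdiff (f := fun k => localPoly 0 c (u k)) hVW
      have h5 : W.card * T' ≤ V.card * (T' / γ) := by
        rw [mul_div_assoc', le_div_iff₀ hγ]
        nlinarith
      simp only [Finset.sum_const, nsmul_eq_mul] at h1 h2 h3
      linarith
    have hku := hup k (hVW hk)
    have h1 : T' / γ = T' * (1 / γ) := by ring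
    have h2 : 0 ≤ T' / γ := by positivity
    have h3 := abs_le.1 (abs_localPoly_zero_sub_le c (hv1 i) (hu k (hVW hk)))
    have h4 : (d + 1 : ℝ) ^ 2 * ‖c‖ * |v i - u k| ≤ K * ‖c‖ * τ := by
      have := hVτ k hk
      gcongr
    rw [abs_le]
    constructor <;> linarith
  have hfin := hAc c _ (by positivity) hR
  have e1 : A * K * τ = 1 / 4 := by rw [hτ]; field_simp
  have e2 : A * (1 + 1 / γ) * K * r = 1 / 4 := by rw [hr]; field_simp
  have e3 : A * (T' * (1 + 1 / γ) + K * ‖c‖ * τ)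
      = A * (1 + 1 / γ) * T + (A * (1 + 1 / γ) * K * r) * ‖c‖ + A * K * τ * ‖c‖ := by
    simp only [T']; ring
  rw [e3, e1, e2] at hfin
  linarith

end Polynomial

/-! ### Pairs of innovations: independence and probabilities -/

section Probability

variable {Ω : Type*} [MeasurableSpace Ω] {μ : Measure Ω}

theorem measurableSet_pair {ε : ℕ → Ω → ℝ} (hm : ∀ k, Measurable (ε k)) (s y : ℝ) (m : ℕ) :
    MeasurableSet {ω | s ≤ ε (2 * m + 1) ω ∧ ε (2 * m + 2) ω ≤ y} :=
  (measurableSet_le measurable_const (hm _)).inter (measurableSet_le (hm _) measurable_const)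

/-- The pairs occupy disjoint indices. Reindexing by `ℕ × Bool` reduces the claim to the product
formula for single innovations. -/
theorem iIndepSet_pair {ε : ℕ → Ω → ℝ} (hm : ∀ k, Measurable (ε k)) (hi : iIndepFun ε μ)
    (s y : ℝ) :
    iIndepSet (fun m : ℕ => {ω | s ≤ ε (2 * m + 1) ω ∧ ε (2 * m + 2) ω ≤ y}) μ := by
  let g : ℕ × Bool → ℕ := fun p => 2 * p.1 + 1 + p.2.toNat
  have hg : Function.Injective g := by
    rintro ⟨m, _ | _⟩ ⟨n, _ | _⟩ h <;> simp [g] at h ⊢ <;> omega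
  let A : ℕ × Bool → Set Ω := fun p =>
    ε (g p) ⁻¹' (bif p.2 then Set.Iic y else Set.Ici s)
  have hA : ∀ S : Finset (ℕ × Bool), μ (⋂ p ∈ S, A p) = ∏ p ∈ S, μ (A p) := fun S =>
    (hi.precomp hg).meas_biInter fun p _ =>
      ⟨_, by cases p.2 <;> simp [measurableSet_Iic, measurableSet_Ici], rfl⟩
  have hpair : ∀ m, {ω | s ≤ ε (2 * m + 1) ω ∧ ε (2 * m + 2) ω ≤ y} = A (m, true) ∩ A (m, false) :=
    fun m => by ext ω; simp [A, g, and_comm]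
  rw [iIndepSet_iff_meas_biInter (measurableSet_pair hm s y)]
  intro S
  have h2 : ∀ m, μ (A (m, true) ∩ A (m, false)) = μ (A (m, true)) * μ (A (m, false)) := fun m => by
    simpa [Finset.prod_product] using hA ({m} ×ˢ Finset.univ)
  have h3 : (⋂ m ∈ S, A (m, true) ∩ A (m, false)) = ⋂ p ∈ S ×ˢ (Finset.univ : Finset Bool), A p := by
    ext ω
    simp only [Set.mem_iInter, Finset.mem_product, Finset.mem_univ, and_true, Prod.forall,
      Bool.forall_bool, Set.mem_inter_iff]
    exact ⟨fun h m => ⟨fun hm => (h m hm).2, fun hm => (h m hm).1⟩,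
      fun h m hm => ⟨(h m).2 hm, (h m).1 hm⟩⟩
  simp only [hpair, h3, hA, Finset.prod_product, h2]
  simp

/-- Independence gives a product of factors `1 - p`, with `p` the success probability of one pair,
and `1 - p ≤ exp (-p)`. Measurable versions replace the innovations, which are only a.e. measurable.
-/
theorem measureReal_forall_pair_le [IsProbabilityMeasure μ] {ε : ℕ → Ω → ℝ}
    (hm : ∀ k, AEMeasurable (ε k) μ) (hi : iIndepFun ε μ)
    (hid : ∀ k, IdentDistrib (ε k) (ε 0) μ μ) (s y : ℝ) (S : Finset ℕ) :
    μ.real {ω | ∀ m ∈ S, ¬ (s ≤ ε (2 * m + 1) ω ∧ ε (2 * m + 2) ω ≤ y)}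
      ≤ Real.exp (-(μ.real {ω | s ≤ ε 0 ω} * distFun μ (ε 0) y * S.card)) := by
  let ε' : ℕ → Ω → ℝ := fun k => (hm k).mk (ε k)
  have hm' : ∀ k, Measurable (ε' k) := fun k => (hm k).measurable_mk
  have hae : ∀ k, ε k =ᵐ[μ] ε' k := fun k => (hm k).ae_eq_mk
  have hi' : iIndepFun ε' μ := hi.congr hae
  have hset := iIndepSet_pair hm' hi' s y
  have hae' : ∀ᵐ ω ∂μ, ∀ k, ε k ω = ε' k ω := ae_all_iff.2 hae
  have hcongr : ({ω | ∀ m ∈ S, ¬ (s ≤ ε (2 * m + 1) ω ∧ ε (2 * m + 2) ω ≤ y)} : Set Ω) =ᵐ[μ]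
      ⋂ m ∈ S, {ω | s ≤ ε' (2 * m + 1) ω ∧ ε' (2 * m + 2) ω ≤ y}ᶜ := by
    filter_upwards [hae'] with ω hω
    refine propext ?_
    change (∀ m ∈ S, ¬ (s ≤ ε (2 * m + 1) ω ∧ ε (2 * m + 2) ω ≤ y)) ↔
      ω ∈ ⋂ m ∈ S, {ω | s ≤ ε' (2 * m + 1) ω ∧ ε' (2 * m + 2) ω ≤ y}ᶜ
    simp [hω]
  have hprod : μ (⋂ m ∈ S, {ω | s ≤ ε' (2 * m + 1) ω ∧ ε' (2 * m + 2) ω ≤ y}ᶜ)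
      = ∏ m ∈ S, μ {ω | s ≤ ε' (2 * m + 1) ω ∧ ε' (2 * m + 2) ω ≤ y}ᶜ :=
    iIndep.meas_biInter hset fun m _ =>
      (MeasurableSpace.measurableSet_generateFrom (Set.mem_singleton _)).compl
  have hidm : ∀ k (B : Set ℝ), MeasurableSet B → μ.real (ε' k ⁻¹' B) = μ.real (ε 0 ⁻¹' B) :=
    fun k B hB => by
      rw [measureReal_def, measureReal_def, ← (hid k).measure_preimage_eq hB]
      congr 1
      refine measure_congr ?_
      filter_upwards [hae k] with ω hω
      refine propext ?_
      change ε' k ω ∈ B ↔ ε k ω ∈ B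
      rw [hω]
  have hone : ∀ m, μ.real {ω | s ≤ ε' (2 * m + 1) ω ∧ ε' (2 * m + 2) ω ≤ y}
      = μ.real {ω | s ≤ ε 0 ω} * distFun μ (ε 0) y := fun m => by
    have h1 := (hi'.indepFun (i := 2 * m + 1) (j := 2 * m + 2) (by omega)).measure_inter_preimage_eq_mul
      (Set.Ici s) (Set.Iic y) measurableSet_Ici measurableSet_Iic
    have h2 := congrArg ENNReal.toReal h1
    rw [ENNReal.toReal_mul] at h2
    exact h2.trans (congrArg₂ (· * ·) (hidm _ _ measurableSet_Ici) (hidm _ _ measurableSet_Iic))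
  rw [measureReal_congr hcongr, measureReal_def, hprod, ENNReal.toReal_prod]
  have hc : ∀ m ∈ S, (μ {ω | s ≤ ε' (2 * m + 1) ω ∧ ε' (2 * m + 2) ω ≤ y}ᶜ).toReal
      ≤ Real.exp (-(μ.real {ω | s ≤ ε 0 ω} * distFun μ (ε 0) y)) := fun m _ => by
    rw [← measureReal_def, probReal_compl_eq_one_sub (measurableSet_pair hm' s y m), hone]
    exact Real.one_sub_le_exp_neg _
  refine (Finset.prod_le_prod (fun _ _ => ENNReal.toReal_nonneg) hc).trans_eq ?_
  rw [Finset.prod_const, ← Real.exp_nat_mul]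
  congr 1
  ring

variable {a : ℝ} {ε : ℕ → Ω → ℝ}

/-- Near `0` the error `cg * y ^ (a + δ)` is at most half of the main term. -/
theorem Innovations.exists_le_distFun (hε : Innovations μ a ε) :
    ∃ c > 0, ∃ y₀ > 0, ∀ y, 0 < y → y < y₀ → c * y ^ a ≤ distFun μ (ε 0) y := by
  obtain ⟨δ, hδ, c, hc, cg, hcg, h⟩ := hε.sharp
  have hlim : Tendsto (fun y : ℝ => cg * y ^ δ) (𝓝[>] 0) (𝓝 0) := by
    have : ContinuousAt (fun y : ℝ => cg * y ^ δ) 0 :=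
      continuousAt_const.mul (Real.continuousAt_rpow_const _ _ (Or.inr hδ.le))
    simpa [Real.zero_rpow hδ.ne'] using this.tendsto.mono_left nhdsWithin_le_nhds
  have h2 := h.and (hlim.eventually_lt_const (half_pos hc))
  obtain ⟨y₀, hy₀, hy⟩ := mem_nhdsGT_iff_exists_Ioo_subset.1 h2
  refine ⟨c / 2, half_pos hc, y₀, hy₀, fun y hy0 hy1 => ?_⟩
  obtain ⟨h3, h4⟩ := hy ⟨hy0, hy1⟩
  rw [Real.rpow_add hy0] at h3
  have h5 := (abs_le.1 h3).1
  have h6 : 0 < y ^ a := Real.rpow_pos_of_pos hy0 a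
  nlinarith

theorem Innovations.measure_nonpos_eq_zero [IsProbabilityMeasure μ] (hε : Innovations μ a ε) :
    μ.real {ω | ε 0 ω ≤ 0} = 0 := by
  obtain ⟨δ, hδ, c, hc, cg, hcg, h⟩ := hε.sharp
  have ha := hε.a_pos
  have hlim : Tendsto (fun y : ℝ => c * y ^ a + cg * y ^ (a + δ)) (𝓝[>] 0) (𝓝 0) := by
    have : ContinuousAt (fun y : ℝ => c * y ^ a + cg * y ^ (a + δ)) 0 :=
      (continuousAt_const.mul (Real.continuousAt_rpow_const _ _ (Or.inr ha.le))).add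
        (continuousAt_const.mul (Real.continuousAt_rpow_const _ _ (Or.inr (by positivity))))
    simpa [Real.zero_rpow ha.ne', Real.zero_rpow (add_pos ha hδ).ne'] using
      this.tendsto.mono_left nhdsWithin_le_nhds
  refine le_antisymm (ge_of_tendsto hlim ?_) measureReal_nonneg
  filter_upwards [h, self_mem_nhdsWithin] with y hy hy0
  have h1 : μ.real {ω | ε 0 ω ≤ 0} ≤ distFun μ (ε 0) y :=
    measureReal_mono fun ω (hω : ε 0 ω ≤ 0) => hω.trans (le_of_lt hy0)
  linarith [(abs_le.1 hy).2]

theorem Innovations.ae_pos [IsProbabilityMeasure μ] (hε : Innovations μ a ε) :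
    ∀ᵐ ω ∂μ, ∀ k, 0 < ε k ω := by
  refine ae_all_iff.2 fun k => ?_
  have h0 : μ {ω | ε 0 ω ≤ 0} = 0 := by
    have := hε.measure_nonpos_eq_zero
    rwa [measureReal_eq_zero_iff] at this
  have h1 : μ (ε k ⁻¹' Set.Iic 0) = 0 := by
    rw [(hε.ident k).measure_preimage_eq measurableSet_Iic]; exact h0
  rw [ae_iff]
  simpa [Set.preimage, not_lt] using h1

theorem Innovations.exists_pos_measure_ge [IsProbabilityMeasure μ] (hε : Innovations μ a ε) :
    ∃ s > 0, 0 < μ.real {ω | s ≤ ε 0 ω} := by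
  by_contra! hcon
  have h1 : ∀ n : ℕ, μ {ω | 1 / ((n : ℝ) + 1) ≤ ε 0 ω} = 0 := fun n => by
    rw [← measureReal_eq_zero_iff]
    exact le_antisymm (hcon _ (by positivity)) measureReal_nonneg
  have h2 : ∀ᵐ ω ∂μ, ∀ n : ℕ, ¬ 1 / ((n : ℝ) + 1) ≤ ε 0 ω := ae_all_iff.2 fun n => by
    rw [ae_iff]; simpa using h1 n
  have h3 : ∀ᵐ _ω ∂μ, False := by
    filter_upwards [h2, hε.ae_pos] with ω hω hpos
    obtain ⟨n, hn⟩ := exists_nat_one_div_lt (hpos 0)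
    exact hω n hn.le
  simp at h3
  exact IsProbabilityMeasure.ne_zero μ h3

end Probability

/-! ### One-sided bounds for the quotients -/

section Quotients

variable {Ω : Type*} {f : ℝ → ℝ} {ε : ℕ → Ω → ℝ} {X₀ : Ω → ℝ} {N : ℕ} {ω : Ω}

theorem process_pos (hf : ∀ y ∈ Set.Icc (0 : ℝ) 1, 0 ≤ f y) (hε : ∀ k, 0 < ε k ω)
    (h0 : 0 < X₀ ω) {k : ℕ} (hk : k ≤ N) : 0 < process f ε X₀ N k ω := by
  induction k with
  | zero => exact h0
  | succ k ih =>
    have h1 : (((k + 1 : ℕ) : ℝ) / N) ∈ Set.Icc (0 : ℝ) 1 :=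
      ⟨by positivity, div_le_one_of_le₀ (by exact_mod_cast hk) (Nat.cast_nonneg _)⟩
    exact add_pos_of_nonneg_of_pos (mul_nonneg (hf _ h1) (ih (by omega)).le) (hε _)

theorem le_process_succ (hf : ∀ y ∈ Set.Icc (0 : ℝ) 1, 0 ≤ f y) (hε : ∀ k, 0 < ε k ω)
    (h0 : 0 < X₀ ω) {k : ℕ} (hk : k + 1 ≤ N) : ε (k + 1) ω ≤ process f ε X₀ N (k + 1) ω := by
  have h1 : (((k + 1 : ℕ) : ℝ) / N) ∈ Set.Icc (0 : ℝ) 1 :=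
    ⟨by positivity, div_le_one_of_le₀ (by exact_mod_cast hk) (Nat.cast_nonneg _)⟩
  exact le_add_of_nonneg_left
    (mul_nonneg (hf _ h1) (process_pos hf hε h0 (by omega : k ≤ N)).le)

theorem quotient_succ (hf : ∀ y ∈ Set.Icc (0 : ℝ) 1, 0 ≤ f y) (hε : ∀ k, 0 < ε k ω)
    (h0 : 0 < X₀ ω) {k : ℕ} (hk : k + 1 ≤ N) :
    quotient f ε X₀ N (k + 1) ω
      = f (((k + 1 : ℕ) : ℝ) / N) + ε (k + 1) ω / process f ε X₀ N k ω := by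
  have h := process_pos hf hε h0 (by omega : k ≤ N)
  rw [quotient, Nat.add_sub_cancel, process, add_div, mul_div_cancel_right₀ _ h.ne']

theorem le_quotient (hf : ∀ y ∈ Set.Icc (0 : ℝ) 1, 0 ≤ f y) (hε : ∀ k, 0 < ε k ω)
    (h0 : 0 < X₀ ω) {k : ℕ} (hk : 1 ≤ k) (hkN : k ≤ N) :
    f ((k : ℝ) / N) ≤ quotient f ε X₀ N k ω := by
  obtain ⟨k, rfl⟩ := Nat.exists_eq_add_of_le' hk
  rw [quotient_succ hf hε h0 hkN]
  exact le_add_of_nonneg_right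
    (div_pos (hε _) (process_pos hf hε h0 (by omega : k ≤ N))).le

/-- A large innovation keeps the denominator above `s`, since the process dominates its latest
innovation; a small one next then makes the noise ratio at most `t`. -/
theorem quotient_le (hf : ∀ y ∈ Set.Icc (0 : ℝ) 1, 0 ≤ f y) (hε : ∀ k, 0 < ε k ω)
    (h0 : 0 < X₀ ω) {k : ℕ} (hkN : k + 2 ≤ N) {s t : ℝ} (ht : 0 ≤ t)
    (h1 : s ≤ ε (k + 1) ω) (h2 : ε (k + 2) ω ≤ t * s) :
    quotient f ε X₀ N (k + 2) ω ≤ f (((k + 2 : ℕ) : ℝ) / N) + t := by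
  rw [quotient_succ hf hε h0 hkN]
  have h3 := le_process_succ hf hε h0 (by omega : k + 1 ≤ N)
  gcongr
  rw [div_le_iff₀ (process_pos hf hε h0 (by omega : k + 1 ≤ N))]
  exact h2.trans (mul_le_mul_of_nonneg_left (h1.trans h3) ht)

end Quotients

/-! ### Counting design points in windows and cells -/

section Counting

theorem natCast_mem_Ioc_of_mem {lo hi : ℝ} {k : ℕ} (hk : k ∈ Finset.Ioc ⌊lo⌋₊ ⌊hi⌋₊) :
    (k : ℝ) ∈ Set.Ioc lo hi := by
  obtain ⟨h1, h2⟩ := Finset.mem_Ioc.1 hk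
  exact ⟨Nat.lt_of_floor_lt h1, (Nat.le_floor_iff' (by omega)).1 h2⟩

theorem sub_sub_one_le_card_Ioc {lo hi : ℝ} (hlo : 0 ≤ lo) :
    hi - lo - 1 ≤ (Finset.Ioc ⌊lo⌋₊ ⌊hi⌋₊).card := by
  rw [Nat.card_Ioc]
  have h1 := Nat.floor_le hlo
  have h2 := Nat.lt_floor_add_one hi
  have h3 : (⌊hi⌋₊ : ℝ) - ⌊lo⌋₊ ≤ ((⌊hi⌋₊ - ⌊lo⌋₊ : ℕ) : ℝ) := by
    rw [sub_le_iff_le_add]; exact_mod_cast (by omega : ⌊hi⌋₊ ≤ ⌊hi⌋₊ - ⌊lo⌋₊ + ⌊lo⌋₊)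
  linarith

/-- Indices `m` such that `2 * m + 2` lies in `(lo, hi]`. -/
noncomputable def evenCell (lo hi : ℝ) : Finset ℕ := Finset.Ioc ⌊(lo - 2) / 2⌋₊ ⌊(hi - 2) / 2⌋₊

theorem mem_Ioc_of_mem_evenCell {lo hi : ℝ} {m : ℕ} (hm : m ∈ evenCell lo hi) :
    ((2 * m + 2 : ℕ) : ℝ) ∈ Set.Ioc lo hi := by
  obtain ⟨h1, h2⟩ := natCast_mem_Ioc_of_mem hm
  push_cast
  constructor <;> linarith

theorem le_card_evenCell {lo hi : ℝ} (hlo : 0 ≤ lo) :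
    (hi - lo) / 2 - 2 ≤ (evenCell lo hi).card := by
  rcases le_total 2 lo with h | h
  · have := sub_sub_one_le_card_Ioc (lo := (lo - 2) / 2) (hi := (hi - 2) / 2) (by linarith)
    rw [evenCell]
    linarith
  · have := sub_sub_one_le_card_Ioc (lo := 0) (hi := (hi - 2) / 2) le_rfl
    -- Here the lower floor truncates to `0`, so `m = 0` is dropped; the slack `2` pays for it.
    rw [evenCell, Nat.floor_of_nonpos (by linarith : (lo - 2) / 2 ≤ 0)]
    rw [Nat.floor_zero] at this
    linarith

theorem card_le_of_forall_mem_Icc {lo hi : ℝ} (h : lo ≤ hi) {W : Finset ℕ}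
    (hW : ∀ k ∈ W, (k : ℝ) ∈ Set.Icc lo hi) : (W.card : ℝ) ≤ hi - lo + 1 := by
  have h1 : W.card ≤ (Finset.Icc ⌈lo⌉ ⌊hi⌋).card := by
    rw [← Finset.card_map (Nat.castEmbedding (R := ℤ)) (s := W)]
    refine Finset.card_le_card fun z hz => ?_
    obtain ⟨k, hk, rfl⟩ := Finset.mem_map.1 hz
    exact Finset.mem_Icc.2 ⟨Int.ceil_le.2 (by simpa using (hW k hk).1),
      Int.le_floor.2 (by simpa using (hW k hk).2)⟩
  rw [Int.card_Icc] at h1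
  have h2 : (W.card : ℝ) ≤ ((⌊hi⌋ + 1 - ⌈lo⌉).toNat : ℝ) := by exact_mod_cast h1
  refine h2.trans ?_
  have h3 : (((⌊hi⌋ + 1 - ⌈lo⌉).toNat : ℤ) : ℝ) = (max (⌊hi⌋ + 1 - ⌈lo⌉) 0 : ℤ) := by
    rw [Int.toNat_eq_max]
  rw [← Int.cast_natCast, h3, Int.cast_max]
  push_cast
  refine max_le ?_ (by linarith)
  linarith [Int.floor_le hi, Int.le_ceil lo]

variable {N k : ℕ} {h x : ℝ}

theorem mem_window : k ∈ window N h x ↔ (1 ≤ k ∧ k ≤ N) ∧ |(k : ℝ) / N - x| ≤ h := by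
  simp [window]

theorem mem_window_of_lt (hN : 0 < N) (hx0 : 0 ≤ x) (hxh : x + h ≤ 1)
    (h1 : N * x < k) (h2 : (k : ℝ) ≤ N * (x + h)) : k ∈ window N h x := by
  have hN' : (0 : ℝ) < N := by exact_mod_cast hN
  have hk0 : (0 : ℝ) < k := lt_of_le_of_lt (by positivity) h1
  have hkN : (k : ℝ) ≤ N := h2.trans (mul_le_of_le_one_right hN'.le hxh)
  refine mem_window.2 ⟨⟨by exact_mod_cast hk0, by exact_mod_cast hkN⟩, ?_⟩
  have e1 : x < (k : ℝ) / N := by rwa [lt_div_iff₀' hN']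
  have e2 : (k : ℝ) / N ≤ x + h := by rwa [div_le_iff₀' hN']
  rw [abs_le]
  constructor <;> linarith

theorem mem_window_of_le (hN : 0 < N) (hx1 : x ≤ 1) (hh : h ≤ x)
    (h1 : N * (x - h) < k) (h2 : (k : ℝ) ≤ N * x) : k ∈ window N h x := by
  have hN' : (0 : ℝ) < N := by exact_mod_cast hN
  have hk0 : (0 : ℝ) < k := lt_of_le_of_lt (mul_nonneg hN'.le (by linarith)) h1
  have hkN : (k : ℝ) ≤ N := h2.trans (mul_le_of_le_one_right hN'.le hx1)
  refine mem_window.2 ⟨⟨by exact_mod_cast hk0, by exact_mod_cast hkN⟩, ?_⟩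
  have e1 : x - h < (k : ℝ) / N := by rwa [lt_div_iff₀' hN']
  have e2 : (k : ℝ) / N ≤ x := by rwa [div_le_iff₀' hN']
  rw [abs_le]
  constructor <;> linarith

/-- The cells `(j / J, (j + 1) / J]` of `[-1, 1]` on which the rescaled window is not cut off
by the boundary of `[0, 1]`. -/
noncomputable def cells (x : ℝ) (J : ℕ) : Finset ℤ :=
  open Classical in
  (Finset.Ico (-(J : ℤ)) J).filter fun j => (0 ≤ j ∧ x < 1) ∨ (j < 0 ∧ 0 < x)

theorem card_cells_le (x : ℝ) (J : ℕ) : (cells x J).card ≤ 2 * J := by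
  refine (Finset.card_filter_le _ _).trans ?_
  rw [Int.card_Ico]
  omega

theorem mem_cells {J : ℕ} {j : ℤ} : j ∈ cells x J ↔
    (-(J : ℤ) ≤ j ∧ j < J) ∧ ((0 ≤ j ∧ x < 1) ∨ (j < 0 ∧ 0 < x)) := by
  simp [cells]

/-- The lower end of the `j`-th cell, as a multiple of `1 / N`. -/
noncomputable def cellEnd (N : ℕ) (h x : ℝ) (J : ℕ) (j : ℤ) : ℝ := N * (x + h * (j / J))

theorem cellEnd_add_one_sub {J : ℕ} (j : ℤ) :
    cellEnd N h x J (j + 1) - cellEnd N h x J j = N * h / J := by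
  simp only [cellEnd]; push_cast; ring

theorem cellEnd_nonneg_of_mem (hx : x ∈ Set.Icc (0 : ℝ) 1) (hh : 0 < h) (hx0 : 0 < x → h ≤ x)
    {J : ℕ} (hJ : 0 < J) {j : ℤ} (hj : j ∈ cells x J) : 0 ≤ cellEnd N h x J j := by
  obtain ⟨⟨h1, -⟩, h2⟩ := mem_cells.1 hj
  have hJ' : (0 : ℝ) < J := by exact_mod_cast hJ
  have h3 : (-1 : ℝ) ≤ j / J := by
    rw [le_div_iff₀ hJ']; have : ((-(J : ℤ) : ℤ) : ℝ) ≤ j := by exact_mod_cast h1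
    push_cast at this; linarith
  refine mul_nonneg (Nat.cast_nonneg _) ?_
  rcases h2 with ⟨h4, -⟩ | ⟨-, h4⟩
  · have : (0 : ℝ) ≤ j / J := div_nonneg (by exact_mod_cast h4) hJ'.le
    exact add_nonneg hx.1 (mul_nonneg hh.le this)
  · have := hx0 h4
    nlinarith

theorem mem_window_of_mem_cells (hN : 0 < N) (hx : x ∈ Set.Icc (0 : ℝ) 1) (hh : 0 < h)
    (hx1 : x < 1 → x + h ≤ 1) (hx0 : 0 < x → h ≤ x)
    {J : ℕ} (hJ : 0 < J) {j : ℤ} (hj : j ∈ cells x J)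
    (hk : (k : ℝ) ∈ Set.Ioc (cellEnd N h x J j) (cellEnd N h x J (j + 1))) :
    k ∈ window N h x := by
  obtain ⟨⟨h1, h1'⟩, h2⟩ := mem_cells.1 hj
  have hJ' : (0 : ℝ) < J := by exact_mod_cast hJ
  have hN' : (0 : ℝ) < N := by exact_mod_cast hN
  obtain ⟨hk1, hk2⟩ := hk
  simp only [cellEnd] at hk1 hk2
  rcases h2 with ⟨h4, h5⟩ | ⟨h4, h5⟩
  · refine mem_window_of_lt hN hx.1 (hx1 h5) (lt_of_le_of_lt ?_ hk1) (hk2.trans ?_)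
    · have : (0 : ℝ) ≤ j / J := div_nonneg (by exact_mod_cast h4) hJ'.le
      gcongr
      exact le_add_of_nonneg_right (mul_nonneg hh.le this)
    · have : ((j + 1 : ℤ) : ℝ) / J ≤ 1 := by
        rw [div_le_one hJ']; exact_mod_cast h1'
      gcongr
      exact mul_le_of_le_one_right hh.le this
  · refine mem_window_of_le hN hx.2 (hx0 h5) (lt_of_le_of_lt ?_ hk1) (hk2.trans ?_)
    · have : (-1 : ℝ) ≤ j / J := by
        rw [le_div_iff₀ hJ']; have : ((-(J : ℤ) : ℤ) : ℝ) ≤ j := by exact_mod_cast h1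
        push_cast at this; linarith
      gcongr
      nlinarith
    · have : ((j + 1 : ℤ) : ℝ) / J ≤ 0 :=
        div_nonpos_of_nonpos_of_nonneg (by exact_mod_cast h4) hJ'.le
      gcongr
      nlinarith

theorem exists_mem_cells_of_mem_window (hN : 0 < N) (hh : 0 < h) {J : ℕ} (hJ : 0 < J)
    (hk : k ∈ window N h x) : ∃ j ∈ cells x J, ∀ i : ℕ,
      (i : ℝ) ∈ Set.Ioc (cellEnd N h x J j) (cellEnd N h x J (j + 1)) →
      |((k : ℝ) / N - x) / h - ((i : ℝ) / N - x) / h| ≤ 1 / J := by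
  obtain ⟨⟨hk1, hkN⟩, hkh⟩ := mem_window.1 hk
  have hJ' : (0 : ℝ) < J := by exact_mod_cast hJ
  have hN' : (0 : ℝ) < N := by exact_mod_cast hN
  have hk0 : (0 : ℝ) < k / N := div_pos (by exact_mod_cast hk1) hN'
  have hkle : (k : ℝ) / N ≤ 1 := div_le_one_of_le₀ (by exact_mod_cast hkN) hN'.le
  set u : ℝ := ((k : ℝ) / N - x) / h with hu
  have huh : u * h = (k : ℝ) / N - x := div_mul_cancel₀ _ hh.ne'
  have hu1 : |u| ≤ 1 := by
    rw [hu, abs_div, abs_of_pos hh]; exact div_le_one_of_le₀ hkh hh.le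
  obtain ⟨hul, hur⟩ := abs_le.1 hu1
  obtain ⟨j, hj, hj1, hj2⟩ : ∃ j ∈ cells x J, (j : ℝ) ≤ J * u ∧ J * u ≤ j + 1 := by
    have hc1 := Int.ceil_lt_add_one (J * u)
    have hc2 := Int.le_ceil (J * u)
    have hcJ : ⌈J * u⌉ ≤ (J : ℤ) := Int.ceil_le.2 (by push_cast; nlinarith)
    -- Cells are open on the left, hence the ceiling minus one; the maximum handles `u = -1`. The
    -- point `u = 0` goes to cell `-1`, which is available since then `x = k / N > 0`.
    refine ⟨max (⌈J * u⌉ - 1) (-(J : ℤ)), mem_cells.2 ⟨by omega, ?_⟩, ?_, ?_⟩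
    · rcases lt_or_ge 0 u with h0 | h0
      · left
        have : 0 < ⌈J * u⌉ := Int.ceil_pos.2 (mul_pos hJ' h0)
        refine ⟨by omega, ?_⟩
        nlinarith
      · right
        have : ⌈J * u⌉ ≤ 0 := Int.ceil_le.2 (by push_cast; nlinarith)
        refine ⟨by omega, ?_⟩
        nlinarith
    · rw [Int.cast_max]
      push_cast
      exact max_le (by linarith) (by nlinarith)
    · rw [Int.cast_max]
      push_cast
      linarith [le_max_left ((⌈J * u⌉ : ℝ) - 1) (-(J : ℝ))]
  refine ⟨j, hj, fun i hi => ?_⟩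
  set w : ℝ := ((i : ℝ) / N - x) / h with hw
  have hwh : w * h = (i : ℝ) / N - x := div_mul_cancel₀ _ hh.ne'
  have hi' : (i : ℝ) = N * (x + h * w) := by
    rw [mul_comm h w, hwh]; field_simp; ring
  obtain ⟨h1, h2⟩ := hi
  simp only [cellEnd] at h1 h2
  rw [hi'] at h1 h2
  have h3 : (j : ℝ) / J < w :=
    lt_of_mul_lt_mul_left (lt_of_add_lt_add_left (lt_of_mul_lt_mul_left h1 hN'.le)) hh.le
  have h4 : w ≤ ((j + 1 : ℤ) : ℝ) / J :=
    le_of_mul_le_mul_left (le_of_add_le_add_left (le_of_mul_le_mul_left h2 hN')) hh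
  push_cast at h4
  have h5 : (j : ℝ) / J ≤ u := by rw [div_le_iff₀' hJ']; exact hj1
  have h6 : u ≤ ((j : ℝ) + 1) / J := by rw [le_div_iff₀' hJ']; exact hj2
  have h7 : ((j : ℝ) + 1) / J = j / J + 1 / J := add_div _ _ _
  rw [abs_le]
  constructor <;> linarith

end Counting

/-! ### Deterministic error bound for the linear program -/

section Deterministic

variable {d : ℕ}

theorem localPoly_sub (x : ℝ) (b b' : Fin (d + 1) → ℝ) (y : ℝ) :
    localPoly x (b - b') y = localPoly x b y - localPoly x b' y := by
  simp [localPoly, sub_mul, Finset.sum_sub_distrib]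

theorem localPoly_single_zero (x B y : ℝ) :
    localPoly x (Pi.single 0 B : Fin (d + 1) → ℝ) y = B := by
  rw [localPoly, Finset.sum_eq_single 0] <;> simp +contextual

theorem localPoly_rescale {h : ℝ} (hh : h ≠ 0) (x : ℝ) (b : Fin (d + 1) → ℝ) (y : ℝ) :
    localPoly 0 (fun i => b i * h ^ (i : ℕ)) ((y - x) / h) = localPoly x b y := by
  refine Finset.sum_congr rfl fun i _ => ?_
  rw [sub_zero, div_pow, mul_assoc, mul_div_cancel₀ _ (pow_ne_zero _ hh)]

/-- Interpolation nodes inside the part of `[-1, 1]` on the side `σ` of the origin. -/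
theorem exists_nodes (σ : ℝ) (hσ : |σ| = 1) (d : ℕ) :
    ∃ v : Fin (d + 1) → ℝ, Function.Injective v ∧ (∀ i, |v i| ≤ 1) ∧ ∃ τ : ℝ, 0 < τ ∧
      ∀ i, τ ≤ σ * v i ∧ σ * v i ≤ 1 - τ := by
  have hσ2 : σ * σ = 1 := by rw [← abs_mul_abs_self, hσ, one_mul]
  have hd : (0 : ℝ) < d + 2 := by positivity
  have hi : ∀ i : Fin (d + 1), 1 / ((d : ℝ) + 2) ≤ ((i : ℕ) + 1 : ℝ) / (d + 2) ∧
      ((i : ℕ) + 1 : ℝ) / (d + 2) ≤ 1 - 1 / (d + 2) := fun i => by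
    have h1 : ((i : ℕ) : ℝ) ≤ d := by exact_mod_cast Nat.lt_succ_iff.1 i.2
    have h0 : (0 : ℝ) ≤ (i : ℕ) := Nat.cast_nonneg _
    refine ⟨div_le_div_of_nonneg_right (by linarith) hd.le, ?_⟩
    rw [one_sub_div hd.ne']
    exact div_le_div_of_nonneg_right (by linarith) hd.le
  refine ⟨fun i => σ * (((i : ℕ) + 1 : ℝ) / (d + 2)), fun i j hij => ?_, fun i => ?_,
    1 / ((d : ℝ) + 2), by positivity, fun i => ?_⟩
  · have h1 : σ ≠ 0 := by rintro rfl; simp at hσ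
    have h2 := mul_left_cancel₀ h1 hij
    rw [div_left_inj' hd.ne', add_left_inj, Nat.cast_inj] at h2
    exact Fin.ext h2
  · rw [abs_mul, hσ, one_mul, abs_of_pos (by positivity)]
    have : 0 < 1 / ((d : ℝ) + 2) := by positivity
    linarith [(hi i).2]
  · simp only [← mul_assoc, hσ2, one_mul]
    exact hi i

/-- If every cell contains an observation close to the regression function, then every solution
of the linear program is close to the local polynomial approximation. -/
theorem exists_abs_sub_le (d : ℕ) {x : ℝ} (hx : x ∈ Set.Icc (0 : ℝ) 1) :
    ∃ J : ℕ, 0 < J ∧ ∃ C : ℝ, 0 < C ∧ ∃ D : ℝ, ∀ (N : ℕ) (h : ℝ), 0 < N → 0 < h →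
      (x < 1 → x + h ≤ 1) → (0 < x → h ≤ x) → D ≤ N * h →
      ∀ (Y g : ℕ → ℝ) (b₀ b : Fin (d + 1) → ℝ) (B T : ℝ), 0 ≤ B → 0 ≤ T →
        (∀ k ∈ window N h x, |g k - localPoly x b₀ ((k : ℝ) / N)| ≤ B) →
        (∀ k ∈ window N h x, g k ≤ Y k) →
        (∀ j ∈ cells x J, ∃ k : ℕ,
          (k : ℝ) ∈ Set.Ioc (cellEnd N h x J j) (cellEnd N h x J (j + 1)) ∧ Y k ≤ g k + T) →
        IsQuasiMLE d N h x Y b → |b 0 - b₀ 0| ≤ C * (T + 2 * B) + B := by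
  -- At a boundary point only one side of `x` carries design points, so all interpolation nodes are
  -- put on one available side.
  obtain ⟨σ, hσ, hσx⟩ : ∃ σ : ℝ, |σ| = 1 ∧ ((σ = 1 ∧ x < 1) ∨ (σ = -1 ∧ 0 < x)) := by
    rcases lt_or_ge x 1 with h | h
    · exact ⟨1, by simp, Or.inl ⟨rfl, h⟩⟩
    · exact ⟨-1, by simp, Or.inr ⟨rfl, by linarith⟩⟩
  obtain ⟨v, hv, hv1, τ₁, hτ₁, hvτ⟩ := exists_nodes σ hσ d
  obtain ⟨τ₂, hτ₂, H⟩ := exists_norm_le_of_sum_nonneg hv hv1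
  set τ : ℝ := min τ₁ τ₂
  have hτ : 0 < τ := lt_min hτ₁ hτ₂
  -- The fraction `τ / 3` works because the window has at most `2 * N * h + 1 ≤ 3 * N * h` points,
  -- and a `τ`-neighbourhood of a node at least `2 * τ * N * h - 1 ≥ τ * N * h`; `D` below ensures
  -- both last inequalities.
  obtain ⟨r, hr, C, hC, H⟩ := H (τ / 3) (by positivity)
  obtain ⟨n, hn⟩ := exists_nat_one_div_lt hr
  refine ⟨n + 1, n.succ_pos, C, hC, max 1 (1 / τ), ?_⟩
  intro N h hN hh hx1 hx0 hD Y g b₀ b B T hB hT hb₀ hgY hcell hb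
  have hN' : (0 : ℝ) < N := by exact_mod_cast hN
  have hD1 : 1 ≤ N * h := (le_max_left _ _).trans hD
  have hD2 : 1 ≤ τ * (N * h) := by
    have := (le_max_right 1 (1 / τ)).trans hD
    rwa [div_le_iff₀' hτ] at this
  set W := window N h x
  set u : ℕ → ℝ := fun k => ((k : ℝ) / N - x) / h
  -- Lowering the approximation by `B` puts it below `g`, hence below `Y`: a feasible competitor.
  set b₁ : Fin (d + 1) → ℝ := b₀ - Pi.single 0 B
  set c : Fin (d + 1) → ℝ := fun i => (b - b₁) i * h ^ (i : ℕ)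
  have hp1 : ∀ y, localPoly x b₁ y = localPoly x b₀ y - B := fun y => by
    rw [localPoly_sub, localPoly_single_zero]
  have hc : ∀ k, localPoly 0 c (u k) = localPoly x b ((k : ℝ) / N) - localPoly x b₁ ((k : ℝ) / N) :=
    fun k => by rw [← localPoly_sub]; exact localPoly_rescale hh.ne' x (b - b₁) _
  have hcellW : ∀ j ∈ cells x (n + 1), ∀ k : ℕ,
      (k : ℝ) ∈ Set.Ioc (cellEnd N h x (n + 1) j) (cellEnd N h x (n + 1) (j + 1)) → k ∈ W :=
    fun j hj k hk => mem_window_of_mem_cells hN hx hh hx1 hx0 n.succ_pos hj hk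
  have hu1 : ∀ k ∈ W, |u k| ≤ 1 := fun k hk => by
    simp only [u]
    rw [abs_div, abs_of_pos hh]
    exact div_le_one_of_le₀ (mem_window.1 hk).2 hh.le
  have hnear : ∀ i, ∃ V ⊆ W, τ / 3 * W.card ≤ V.card ∧ ∀ k ∈ V, |v i - u k| ≤ τ₂ := fun i => by
    have hWc : (W.card : ℝ) ≤ 3 * (N * h) := by
      have := card_le_of_forall_mem_Icc (lo := N * (x - h)) (hi := N * (x + h)) (W := W)
        (by gcongr; linarith) fun k hk => by
          have h1 := abs_le.1 (mem_window.1 hk).2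
          have h2 : (k : ℝ) = N * (k / N) := by field_simp
          rw [h2]
          constructor <;> gcongr <;> linarith
      linarith
    have hvi : -1 ≤ v i - τ := by
      have := abs_le.1 (hv1 i)
      have := hvτ i
      have h4 : τ ≤ τ₁ := min_le_left _ _
      rcases hσx with ⟨rfl, -⟩ | ⟨rfl, -⟩ <;> linarith
    have hlo : 0 ≤ N * (x + h * (v i - τ)) := by
      refine mul_nonneg hN'.le ?_
      have h1 := hvτ i
      have h4 : τ ≤ τ₁ := min_le_left _ _
      rcases hσx with ⟨rfl, -⟩ | ⟨rfl, h3⟩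
      · exact add_nonneg hx.1 (mul_nonneg hh.le (by linarith))
      · have := hx0 h3
        nlinarith
    have hV : ∀ k ∈ Finset.Ioc ⌊(N * (x + h * (v i - τ)) : ℝ)⌋₊ ⌊(N * (x + h * (v i + τ)) : ℝ)⌋₊,
        v i - τ < u k ∧ u k ≤ v i + τ := fun k hk => by
      obtain ⟨h1, h2⟩ := natCast_mem_Ioc_of_mem hk
      have hk : (k : ℝ) = N * (x + h * u k) := by
        simp only [u]; field_simp; ring
      rw [hk] at h1 h2
      exact ⟨lt_of_mul_lt_mul_left (lt_of_add_lt_add_left (lt_of_mul_lt_mul_left h1 hN'.le)) hh.le,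
        le_of_mul_le_mul_left (le_of_add_le_add_left (le_of_mul_le_mul_left h2 hN')) hh⟩
    have hτ1 : τ ≤ τ₁ := min_le_left _ _
    have hτ2 : τ ≤ τ₂ := min_le_right _ _
    have hvi' := hvτ i
    refine ⟨Finset.Ioc ⌊(N * (x + h * (v i - τ)) : ℝ)⌋₊ ⌊(N * (x + h * (v i + τ)) : ℝ)⌋₊,
      fun k hk => ?_, ?_, fun k hk => ?_⟩
    · obtain ⟨h1, h2⟩ := hV k hk
      have hk : (k : ℝ) = N * (x + h * u k) := by
        simp only [u]; field_simp; ring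
      rcases hσx with ⟨rfl, h3⟩ | ⟨rfl, h3⟩
      · have h4 : 0 < u k := by linarith
        have h5 : u k ≤ 1 := by linarith
        refine mem_window_of_lt hN hx.1 (hx1 h3) ?_ ?_
        · rw [hk]; gcongr; exact lt_add_of_pos_right _ (mul_pos hh h4)
        · rw [hk]; gcongr; exact mul_le_of_le_one_right hh.le h5
      · have h4 : u k ≤ 0 := by linarith
        have h5 : -1 < u k := by linarith
        refine mem_window_of_le hN hx.2 (hx0 h3) ?_ ?_
        · rw [hk]; gcongr; nlinarith
        · rw [hk]; gcongr; nlinarith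
    · have h1 := sub_sub_one_le_card_Ioc (hi := N * (x + h * (v i + τ))) hlo
      have h2 : N * (x + h * (v i + τ)) - N * (x + h * (v i - τ)) = 2 * (τ * (N * h)) := by ring
      have h3 : τ / 3 * W.card ≤ τ / 3 * (3 * (N * h)) := by gcongr
      linarith
    · have := hV k hk
      rw [abs_le]
      constructor <;> linarith
  obtain ⟨hfeas, hmax⟩ := hb
  have hb₁ : b₁ ∈ feasible d N h x Y := fun k hk => by
    rw [hp1]
    linarith [hgY k hk, (abs_le.1 (hb₀ k hk)).1]
  have hsum : 0 ≤ ∑ k ∈ W, localPoly 0 c (u k) := by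
    simp only [hc, Finset.sum_sub_distrib, sub_nonneg]
    exact hmax hb₁
  have hdense : ∀ k ∈ W, ∃ k' ∈ W, |u k - u k'| ≤ r ∧ localPoly 0 c (u k') ≤ T + 2 * B :=
    fun k hk => by
      obtain ⟨j, hj, hjk⟩ := exists_mem_cells_of_mem_window hN hh n.succ_pos hk
      obtain ⟨k', hk', hY⟩ := hcell j hj
      have hk'W := hcellW j hj k' hk'
      refine ⟨k', hk'W, (hjk k' hk').trans ?_, ?_⟩
      · push_cast
        exact hn.le
      · rw [hc, hp1]
        have h1 : localPoly x b ((k' : ℝ) / N) ≤ Y k' := hfeas k' hk'W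
        linarith [(abs_le.1 (hb₀ k' hk'W)).2]
  have hWne : W.Nonempty := by
    obtain ⟨j, hj⟩ : (cells x (n + 1)).Nonempty := by
      rcases hσx with ⟨-, h3⟩ | ⟨-, h3⟩
      · exact ⟨0, mem_cells.2 ⟨by omega, Or.inl ⟨le_rfl, h3⟩⟩⟩
      · exact ⟨-1, mem_cells.2 ⟨by omega, Or.inr ⟨by omega, h3⟩⟩⟩
    obtain ⟨k, hk, -⟩ := hcell j hj
    exact ⟨k, hcellW j hj k hk⟩
  have hfin := H W u c (T + 2 * B) (by positivity) hWne hu1 hsum hdense hnear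
  have hc0 : c 0 = b 0 - b₀ 0 + B := by simp [c, b₁]; ring
  have h1 : |c 0| ≤ ‖c‖ := norm_le_pi_norm c 0
  have h2 : b 0 - b₀ 0 = c 0 - B := by rw [hc0]; ring
  rw [h2]
  refine (abs_sub _ _).trans ?_
  rw [abs_of_nonneg hB]
  linarith

end Deterministic

/-! ### Asymptotics of the bandwidth -/

section Bandwidth

variable {a β : ℝ}

theorem tendsto_bandwidth (ha : 0 < a) (hβ : 0 < β) : Tendsto (bandwidth a β) atTop (𝓝 0) := by
  have h := (tendsto_rpow_neg_atTop (y := 1 / (a * β + 1)) (by positivity)).comp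
    (tendsto_natCast_atTop_atTop (R := ℝ))
  simp only [Function.comp_def, ← neg_div] at h
  exact h

/-- The balance defining the bandwidth: the expected number of successful pairs at noise level `h ^
β` stays of order one. -/
theorem mul_bandwidth_mul_rpow (ha : 0 < a) (hβ : 0 < β) {N : ℕ} (hN : 0 < N) :
    N * bandwidth a β N * (bandwidth a β N ^ β) ^ a = 1 := by
  have hN' : (0 : ℝ) < N := by exact_mod_cast hN
  have he : a * β + 1 ≠ 0 := by positivity
  rw [bandwidth, ← Real.rpow_mul hN'.le, ← Real.rpow_mul hN'.le]
  nth_rewrite 1 [← Real.rpow_one (N : ℝ)]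
  rw [← Real.rpow_add hN', ← Real.rpow_add hN']
  convert Real.rpow_zero (N : ℝ) using 2
  field_simp
  ring

theorem tendsto_mul_bandwidth (ha : 0 < a) (hβ : 0 < β) : Tendsto (fun N : ℕ => N * bandwidth a β N) atTop atTop := by
  have h := (tendsto_rpow_atTop (y := a * β / (a * β + 1)) (by positivity)).comp
    (tendsto_natCast_atTop_atTop (R := ℝ))
  refine h.congr' ?_
  filter_upwards [eventually_gt_atTop 0] with N hN
  have hN' : (0 : ℝ) < N := by exact_mod_cast hN
  have he : a * β + 1 ≠ 0 := by positivity
  simp only [Function.comp, bandwidth]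
  nth_rewrite 2 [← Real.rpow_one (N : ℝ)]
  rw [← Real.rpow_add hN']
  congr 1
  field_simp
  ring

end Bandwidth

end TvAR


/-! ### The convergence rate -/

theorem corollary1 {Ω : Type*} [MeasurableSpace Ω] (μ : Measure Ω) [IsProbabilityMeasure μ]
    (ε : ℕ → Ω → ℝ) (a : ℝ) (hε : TvAR.Innovations μ a ε)
    (L β ρ : ℝ) (hL : 0 < L) (hβ : 0 < β) (hρ : ρ < 1)
    (x : ℝ) (hx : x ∈ Set.Icc (0 : ℝ) 1)
    (d : ℕ) (hd : TvAR.holderOrder β ≤ d) :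
    ∀ η : ℝ, 0 < η → ∃ v : ℝ, 0 < v ∧ ∃ N₀ : ℕ, ∀ N : ℕ, N₀ ≤ N →
      ∀ f : ℝ → ℝ, TvAR.HolderClass L β f → (∀ y ∈ Set.Icc (0 : ℝ) 1, 0 ≤ f y ∧ f y ≤ ρ) →
      ∀ X₀ : Ω → ℝ, AEMeasurable X₀ μ → (∀ᵐ ω ∂μ, 0 < X₀ ω) →
      ∀ b : Ω → Fin (d + 1) → ℝ,
        (∀ᵐ ω ∂μ, TvAR.IsQuasiMLE d N (TvAR.bandwidth a β N) x
          (fun k => TvAR.quotient f ε X₀ N k ω) (b ω)) →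
        μ.real {ω | v * (N : ℝ) ^ (-β / (a * β + 1)) ≤ |b ω 0 - f x|} < η := by
  open TvAR in
  intro η hη
  have ha := hε.a_pos
  obtain ⟨J, hJ, C, hC, D, hdet⟩ := exists_abs_sub_le d hx
  obtain ⟨s, hs, hπ⟩ := hε.exists_pos_measure_ge
  obtain ⟨c, hc, y₀, hy₀, hF⟩ := hε.exists_le_distFun
  set π := μ.real {ω | s ≤ ε 0 ω}
  have hJ' : (0 : ℝ) < J := by exact_mod_cast hJ
  -- The rate combines the pair probability `π * c * (t * s) ^ a` with the `N * h / (4 * J)` pairs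
  -- per cell.
  set κ : ℝ := π * c * s ^ a / (4 * J)
  have hκ : 0 < κ := by positivity
  obtain ⟨w, hw, hwη⟩ : ∃ w : ℝ, 0 < w ∧ 2 * J * Real.exp (-(κ * w ^ a)) < η := by
    have h1 : Tendsto (fun w : ℝ => 2 * J * Real.exp (-(κ * w ^ a))) atTop (𝓝 (2 * J * 0)) :=
      ((Real.tendsto_exp_neg_atTop_nhds_zero.comp
        ((tendsto_rpow_atTop ha).const_mul_atTop hκ)).const_mul _)
    rw [mul_zero] at h1
    exact ((eventually_gt_atTop 0).and (h1.eventually_lt_const hη)).exists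
  -- The deterministic bound with `T = w * h ^ β` and `B = L * h ^ β`; the extra `1` makes the
  -- contradiction strict.
  refine ⟨C * (w + 2 * L) + L + 1, by positivity, ?_⟩
  have hlim : Tendsto (fun N => w * bandwidth a β N ^ β * s) atTop (𝓝 0) := by
    have h1 : ContinuousAt (fun t : ℝ => w * t ^ β * s) 0 :=
      (continuousAt_const.mul (Real.continuousAt_rpow_const _ _ (Or.inr hβ.le))).mul
        continuousAt_const
    have h2 := h1.tendsto.comp (tendsto_bandwidth ha hβ)
    simpa [Real.zero_rpow hβ.ne', Function.comp_def] using h2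
  have hb1 : ∀ᶠ N in atTop, x < 1 → x + bandwidth a β N ≤ 1 := by
    by_cases h : x < 1
    · filter_upwards [(tendsto_bandwidth ha hβ).eventually_le_const (sub_pos.2 h)] with N hN _
      linarith
    · exact Eventually.of_forall fun _ h' => absurd h' h
  have hb0 : ∀ᶠ N in atTop, 0 < x → bandwidth a β N ≤ x := by
    by_cases h : 0 < x
    · filter_upwards [(tendsto_bandwidth ha hβ).eventually_le_const h] with N hN _ using hN
    · exact Eventually.of_forall fun _ h' => absurd h' h
  obtain ⟨N₀, hN₀⟩ := eventually_atTop.1 ((eventually_gt_atTop 0).and (hb1.and (hb0.and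
    (((tendsto_mul_bandwidth ha hβ).eventually_ge_atTop (max D (8 * J))).and
      (hlim.eventually_lt_const hy₀)))))
  refine ⟨N₀, fun N hNN f hf hfρ X₀ _ hX₀ b hb => ?_⟩
  obtain ⟨hN, hx1, hx0, hD, hy⟩ := hN₀ N hNN
  have hN' : (0 : ℝ) < N := by exact_mod_cast hN
  have hf0 : ∀ y ∈ Set.Icc (0 : ℝ) 1, 0 ≤ f y := fun y hy => (hfρ y hy).1
  have hhβ : (N : ℝ) ^ (-β / (a * β + 1)) = bandwidth a β N ^ β := by
    rw [bandwidth, ← Real.rpow_mul hN'.le]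
    congr 1
    ring
  have hscale := mul_bandwidth_mul_rpow ha hβ hN
  have hh : 0 < bandwidth a β N := Real.rpow_pos_of_pos hN' _
  rw [hhβ]
  set h := bandwidth a β N
  have hhβ0 : 0 < h ^ β := Real.rpow_pos_of_pos hh β
  have hD1 : D ≤ N * h := (le_max_left _ _).trans hD
  have hD2 : 8 * J ≤ N * h := (le_max_right _ _).trans hD
  set t := w * h ^ β
  have ht : 0 < t := by positivity
  obtain ⟨b₀, hb₀x, hb₀⟩ := hf.exists_localPoly hL.le hβ hd hx
  let S : ℤ → Finset ℕ := fun j => evenCell (cellEnd N h x J j) (cellEnd N h x J (j + 1))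
  let E : ℤ → Set Ω := fun j =>
    {ω | ∀ m ∈ S j, ¬ (s ≤ ε (2 * m + 1) ω ∧ ε (2 * m + 2) ω ≤ t * s)}
  have hE : ∀ j ∈ cells x J, μ.real (E j) ≤ Real.exp (-(κ * w ^ a)) := fun j hj => by
    refine (measureReal_forall_pair_le hε.aemeasurable hε.indep hε.ident s (t * s) (S j)).trans ?_
    rw [Real.exp_le_exp, neg_le_neg_iff]
    have h1 : N * h / (4 * J) ≤ (S j).card := by
      refine le_trans ?_ (le_card_evenCell (cellEnd_nonneg_of_mem hx hh hx0 hJ hj))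
      rw [cellEnd_add_one_sub]
      -- `8 * J ≤ N * h` lets half of the `N * h / (2 * J)` pairs absorb the rounding loss `2`.
      have h2 : 2 ≤ N * h / (4 * J) := by
        rw [le_div_iff₀ (by positivity)]; linarith
      have h3 : N * h / J / 2 = 2 * (N * h / (4 * J)) := by field_simp; norm_num
      linarith
    have h2 := hF (t * s) (by positivity) hy
    have h3 : κ * w ^ a = π * (c * (t * s) ^ a) * (N * h / (4 * J)) := by
      rw [Real.mul_rpow ht.le hs.le, Real.mul_rpow hw.le hhβ0.le]
      calc κ * w ^ a = κ * w ^ a * (N * h * (h ^ β) ^ a) := by rw [hscale, mul_one]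
        _ = _ := by simp only [κ]; ring
    rw [h3]
    have h4 : 0 ≤ distFun μ (ε 0) (t * s) := measureReal_nonneg
    gcongr
  -- No measurability of `b` is needed: an a.e. inclusion suffices for monotonicity of the outer
  -- measure.
  have hsub : {ω | (C * (w + 2 * L) + L + 1) * h ^ β ≤ |b ω 0 - f x|} ≤ᵐ[μ]
      ⋃ j ∈ cells x J, E j := by
    filter_upwards [hε.ae_pos, hX₀, hb] with ω hεω hXω hbω hω
    change (C * (w + 2 * L) + L + 1) * h ^ β ≤ |b ω 0 - f x| at hω
    change ω ∈ ⋃ j ∈ cells x J, E j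
    by_contra hcon
    simp only [Set.mem_iUnion, not_exists] at hcon
    have hest := hdet N h hN hh hx1 hx0 hD1 (fun k => quotient f ε X₀ N k ω)
      (fun k => f ((k : ℝ) / N)) b₀ (b ω) (L * h ^ β) t (by positivity) ht.le
      (fun k hk => by
        obtain ⟨⟨-, hk2⟩, hk3⟩ := mem_window.1 hk
        refine (hb₀ _ ⟨by positivity, div_le_one_of_le₀ (by exact_mod_cast hk2) hN'.le⟩).trans ?_
        gcongr)
      (fun k hk => by
        obtain ⟨⟨hk1, hk2⟩, -⟩ := mem_window.1 hk
        exact le_quotient hf0 hεω hXω hk1 hk2)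
      (fun j hj => by
        obtain ⟨m, hm, h1, h2⟩ : ∃ m ∈ S j, s ≤ ε (2 * m + 1) ω ∧ ε (2 * m + 2) ω ≤ t * s := by
          have := hcon j hj
          simpa [E] using this
        have hk := mem_Ioc_of_mem_evenCell hm
        have hkW := mem_window_of_mem_cells hN hx hh hx1 hx0 hJ hj hk
        exact ⟨2 * m + 2, hk, quotient_le hf0 hεω hXω (mem_window.1 hkW).1.2 ht.le h1 h2⟩)
      hbω
    rw [hb₀x] at hest
    have : C * (t + 2 * (L * h ^ β)) + L * h ^ β = (C * (w + 2 * L) + L) * h ^ β := by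
      simp only [t]; ring
    linarith
  calc μ.real {ω | (C * (w + 2 * L) + L + 1) * h ^ β ≤ |b ω 0 - f x|}
      ≤ μ.real (⋃ j ∈ cells x J, E j) :=
        ENNReal.toReal_mono (measure_ne_top _ _) (measure_mono_ae hsub)
    _ ≤ ∑ j ∈ cells x J, μ.real (E j) := measureReal_biUnion_finset_le _ _
    _ ≤ ∑ j ∈ cells x J, Real.exp (-(κ * w ^ a)) := Finset.sum_le_sum hE
    _ = (cells x J).card * Real.exp (-(κ * w ^ a)) := by simp
    _ ≤ 2 * J * Real.exp (-(κ * w ^ a)) := by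
        gcongr
        exact_mod_cast card_cells_le x J
    _ < η := hwη
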